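/- For a Laurent series $f(z)=\sum_{n\ge n_0}c_nz^{-n}\in\mathbb{Q}((z^{-1}))$ let $[a_0(z),a_1(z),\dots]$, $a_i\in\mathbb{Q}[z]$, be its continued fraction, obtained by repeatedly splitting off the polynomial part and inverting the remainder, and let $d_k$ be the degree of the denominator $q_k$ of the $k$-th convergent $[a_0(z),\dots,a_k(z)]=p_k(z)/q_k(z)$ written in lowest terms. The irrationality exponent $\mu(\xi)$ of a real number $\xi$ is the supremum of the real numbers $\mu$ for which $|\xi-p/q|<q^{-\mu}$ has infinitely many rational solutions $p/q$ (with $q\ge 1$). Theorem. Let $d\ge 2$ be an integer, let $A,B\in\mathbb{Q}[z]$ with $B\ne 0$, and let $f(z)\in\mathbb{Q}((z^{-1}))$ be a Laurent series which is not a rational function and satisfies $$f(z)=\frac{A(z)}{B(z)}\,f(z^d).$$ Let $b\in\mathbb{Z}$ with $|b|\ge 2$ lie inside the (open) disc of convergence of $f$ (a disc centred at infinity), and suppose that $A(b^{d^m})B(b^{d^m})\ne 0$ for all integers $m\ge 0$. Then $$\mu(f(b))=1+\limsup_{k\to\infty}\frac{d_{k+1}}{d_k}.$$ -/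

import Mathlib

open Filter Polynomial

namespace Mahler

/-! A Laurent series `f = ∑ c_n z^{-n}` in `ℚ((z⁻¹))` is an element of Mathlib's `LaurentSeries ℚ`,
whose formal variable is `z⁻¹`: thus `f.coeff n` is the coefficient `c_n` of `z^{-n}`. -/

/-- The element `z` of `ℚ((z⁻¹))`. -/
noncomputable def z : LaurentSeries ℚ := HahnSeries.single (-1 : ℤ) (1 : ℚ)

/-- A polynomial `P(z)`, regarded as an element of `ℚ((z⁻¹))`. -/
noncomputable def ofPoly (P : ℚ[X]) : LaurentSeries ℚ :=
  P.eval₂ HahnSeries.C z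

/-- `f` is (the expansion at infinity of) a rational function of `z`. -/
def IsRational (f : LaurentSeries ℚ) : Prop :=
  ∃ P Q : ℚ[X], Q ≠ 0 ∧ f = ofPoly P / ofPoly Q

/-- The order embedding `n ↦ d n` of `ℤ`, for `d ≥ 1`. -/
noncomputable def mulEmb (d : ℕ) (hd : 1 ≤ d) : ℤ ↪o ℤ :=
  OrderEmbedding.ofStrictMono (fun n : ℤ => (d : ℤ) * n)
    (fun _ _ h => mul_lt_mul_of_pos_left h (by exact_mod_cast hd))

/-- The Laurent series `f(z^d)`: the coefficient of `z^{-dn}` is `c_n`, the others vanish. -/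
noncomputable def substPow (d : ℕ) (hd : 1 ≤ d) (f : LaurentSeries ℚ) : LaurentSeries ℚ :=
  HahnSeries.embDomain (mulEmb d hd) f

/-- The polynomial part `∑_{i ≥ 0} c_{-i} z^i` of `f`. -/
noncomputable def polyPart (f : LaurentSeries ℚ) : ℚ[X] :=
  ∑ i ∈ Finset.range ((-f.order).toNat + 1), monomial i (f.coeff (-(i : ℤ)))

theorem coeff_polyPart (f : LaurentSeries ℚ) (i : ℕ) :
    (polyPart f).coeff i = f.coeff (-(i : ℤ)) := by
  simp only [polyPart, finsetSum_coeff, coeff_monomial, Finset.sum_ite_eq', Finset.mem_range]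
  split_ifs with h
  · rfl
  · exact (HahnSeries.coeff_eq_zero_of_lt_order (by omega)).symm

/-- The complete quotients of `f`: `f_0 = f` and `f_{k+1} = 1 / (f_k - a_k)`, where `a_k` is the
polynomial part of `f_k`. -/
noncomputable def completeQuotient (f : LaurentSeries ℚ) : ℕ → LaurentSeries ℚ
  | 0 => f
  | k + 1 => (completeQuotient f k - ofPoly (polyPart (completeQuotient f k)))⁻¹

/-- The partial quotients `a_k(z)` of the continued fraction `f = [a_0, a_1, a_2, …]`. -/
noncomputable def partialQuotient (f : LaurentSeries ℚ) (k : ℕ) : ℚ[X] :=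
  polyPart (completeQuotient f k)

/-- The finite continued fraction `[a_0, …, a_k] = a_0 + 1 / [a_1, …, a_k]`. -/
noncomputable def contFract : (ℕ → ℚ[X]) → ℕ → RatFunc ℚ
  | a, 0 => algebraMap ℚ[X] (RatFunc ℚ) (a 0)
  | a, k + 1 => algebraMap ℚ[X] (RatFunc ℚ) (a 0) + (contFract (fun i => a (i + 1)) k)⁻¹

/-- The `k`-th convergent `[a_0, …, a_k]` of the continued fraction of `f`. -/
noncomputable def convergent (f : LaurentSeries ℚ) (k : ℕ) : RatFunc ℚ :=
  contFract (partialQuotient f) k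

/-- The degree `d_k` of the denominator of the `k`-th convergent of `f`, in lowest terms. -/
noncomputable def denDegree (f : LaurentSeries ℚ) (k : ℕ) : ℕ :=
  (convergent f k).denom.natDegree

/-- The radius of convergence, in the variable `w = z⁻¹`, of the series `∑_{n ≥ 0} c_n w^n` (the
remaining terms of `f` are finitely many). -/
noncomputable def convRadius (f : LaurentSeries ℚ) : ENNReal :=
  (FormalMultilinearSeries.ofScalars ℝ (fun n : ℕ => (f.coeff (n : ℤ) : ℝ))).radius

/-- The real points, other than the point at infinity, of the (open) disc of convergence of `f`,
which is a disc centred at infinity. -/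
def discOfConvergence (f : LaurentSeries ℚ) : Set ℝ :=
  {x | x ≠ 0 ∧ ENNReal.ofReal |x|⁻¹ < convRadius f}

/-- The value `f(x) = ∑ c_n x^{-n}` at a point `x` of the disc of convergence. -/
noncomputable def value (f : LaurentSeries ℚ) (x : ℝ) : ℝ :=
  ∑' n : ℤ, (f.coeff n : ℝ) * x ^ (-n)

/-- The irrationality exponent of `ξ`: the supremum of the real `μ` such that `|ξ - p/q| < q^{-μ}`
has infinitely many rational solutions `p/q`. -/
noncomputable def irrationalityExponent (ξ : ℝ) : EReal :=
  sSup ((fun μ : ℝ => (μ : EReal)) ''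
    {μ : ℝ | {x : ℚ | |ξ - (x : ℝ)| < (x.den : ℝ) ^ (-μ)}.Infinite})

end Mahler

namespace Mahler

/-! ### Polynomials as Laurent series in `z⁻¹` -/

/-! Iterating the functional equation m times expresses f(b) as f(b^(d^m)) times the product over t
< m of A/B at b^(d^t). Evaluating the k-th convergent p_k/q_k of f at b^(d^m) and clearing
denominators therefore gives integers P, Q depending on k and m. Put X = |b|^(d^m). Since the
exponents d^t with t < m sum to at most d^m, the products cost only a bounded power of X. As q_k has
degree d_k and q_k f - p_k has order d_{k+1} in 1/z, one gets |Q| ≤ X^(d_k + C) and |Q f(b) - P| ≤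
X^(C - d_{k+1}), where C depends on neither k nor m, for m large in terms of k
(`exists_approximations`).

The rest concerns only such a doubly indexed family. With k fixed and m growing, it yields exponents
close to 1 + d_{k+1}/d_k once d_k dwarfs C (`infinite_of_approximations`). Conversely, a rational x
of large denominator is placed at a suitable scale m and compared with the approximations of indices
k and k + 1, where d_k and d_{k+1} bracket the size of the denominator. These two are not
proportional, so one of them differs from x and keeps x away from f(b) (`finite_of_approximations`).
The index k stays bounded in this argument, so the lack of uniformity in k is harmless. -/

theorem ofPoly_add (P Q : ℚ[X]) : ofPoly (P + Q) = ofPoly P + ofPoly Q := eval₂_add _ _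

theorem ofPoly_mul (P Q : ℚ[X]) : ofPoly (P * Q) = ofPoly P * ofPoly Q := eval₂_mul _ _

theorem ofPoly_one : ofPoly 1 = 1 := eval₂_one _ _

theorem ofPoly_zero : ofPoly 0 = 0 := eval₂_zero _ _

theorem ofPoly_monomial (i : ℕ) (a : ℚ) :
    ofPoly (monomial i a) = HahnSeries.single (-(i : ℤ)) a := by
  rw [ofPoly, eval₂_monomial, z, HahnSeries.single_pow, HahnSeries.C_apply,
    HahnSeries.single_mul_single]
  simp

theorem coeff_ofPoly_neg (P : ℚ[X]) (i : ℕ) : (ofPoly P).coeff (-(i : ℤ)) = P.coeff i := by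
  induction P using Polynomial.induction_on' with
  | add p q hp hq => rw [ofPoly_add, HahnSeries.coeff_add, hp, hq, coeff_add]
  | monomial n a =>
    rw [ofPoly_monomial, coeff_monomial]
    split_ifs with h
    · subst h; simp
    · rw [HahnSeries.coeff_single_of_ne]; omega

theorem ofPoly_injective : Function.Injective ofPoly := by
  intro P Q h
  ext i
  rw [← coeff_ofPoly_neg, h, coeff_ofPoly_neg]

theorem ofPoly_ne_zero {P : ℚ[X]} (hP : P ≠ 0) : ofPoly P ≠ 0 := fun h =>
  hP (ofPoly_injective (h.trans ofPoly_zero.symm))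

theorem order_ofPoly {P : ℚ[X]} (hP : P ≠ 0) : (ofPoly P).order = -(P.natDegree : ℤ) := by
  apply le_antisymm
  · apply HahnSeries.order_le_of_coeff_ne_zero
    rw [coeff_ofPoly_neg]
    exact leadingCoeff_ne_zero.2 hP
  · by_contra! h
    have h0 := HahnSeries.coeff_order_eq_zero.not.2 (ofPoly_ne_zero hP)
    have h1 : (ofPoly P).order = -(((-(ofPoly P).order).toNat : ℕ) : ℤ) := by omega
    rw [h1, coeff_ofPoly_neg] at h0
    have := le_natDegree_of_ne_zero h0
    omega

theorem coeff_sub_polyPart (f : LaurentSeries ℚ) {n : ℤ} (hn : n ≤ 0) :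
    (f - ofPoly (polyPart f)).coeff n = 0 := by
  obtain ⟨i, rfl⟩ : ∃ i : ℕ, n = -(i : ℤ) := ⟨(-n).toNat, by omega⟩
  rw [HahnSeries.coeff_sub, coeff_ofPoly_neg, coeff_polyPart, sub_self]

theorem order_sub_polyPart_pos {f : LaurentSeries ℚ} (h : f - ofPoly (polyPart f) ≠ 0) :
    0 < (f - ofPoly (polyPart f)).order := by
  by_contra! h'
  exact HahnSeries.coeff_order_eq_zero.not.2 h (coeff_sub_polyPart f h')

theorem order_polyPart {f : LaurentSeries ℚ} (h : f ≠ 0) (hf : f.order ≤ 0) :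
    ((polyPart f).natDegree : ℤ) = -f.order := by
  have h1 : f.order = -(((-f.order).toNat : ℕ) : ℤ) := by omega
  have h0 := HahnSeries.coeff_order_eq_zero.not.2 h
  rw [h1, ← coeff_polyPart] at h0
  have h2 := le_natDegree_of_ne_zero h0
  have h3 : (polyPart f).natDegree ≤ (-f.order).toNat := by
    rw [natDegree_le_iff_coeff_eq_zero]
    intro N hN
    rw [coeff_polyPart]
    exact HahnSeries.coeff_eq_zero_of_lt_order (by omega)
  omega

theorem order_inv {f : LaurentSeries ℚ} (h : f ≠ 0) : (f⁻¹).order = -f.order := by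
  have := HahnSeries.order_mul h (inv_ne_zero h)
  rw [mul_inv_cancel₀ h, HahnSeries.order_one] at this
  omega

/-! ### Irrationality of the complete quotients -/

theorem isRational_ofPoly (P : ℚ[X]) : IsRational (ofPoly P) :=
  ⟨P, 1, one_ne_zero, by rw [ofPoly_one, div_one]⟩

theorem IsRational.add {f g : LaurentSeries ℚ} (hf : IsRational f) (hg : IsRational g) :
    IsRational (f + g) := by
  obtain ⟨P, Q, hQ, rfl⟩ := hf
  obtain ⟨P', Q', hQ', rfl⟩ := hg
  refine ⟨P * Q' + Q * P', Q * Q', mul_ne_zero hQ hQ', ?_⟩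
  rw [div_add_div _ _ (ofPoly_ne_zero hQ) (ofPoly_ne_zero hQ')]
  simp only [ofPoly_add, ofPoly_mul]

theorem IsRational.inv {f : LaurentSeries ℚ} (hf : IsRational f) : IsRational f⁻¹ := by
  obtain ⟨P, Q, hQ, rfl⟩ := hf
  by_cases hP : P = 0
  · refine ⟨0, 1, one_ne_zero, ?_⟩
    simp [hP, ofPoly_zero]
  · exact ⟨Q, P, hP, inv_div _ _⟩

theorem not_isRational_inv_sub {f : LaurentSeries ℚ} (hf : ¬ IsRational f) (P : ℚ[X]) :
    ¬ IsRational (f - ofPoly P)⁻¹ := by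
  intro h
  apply hf
  have := h.inv.add (isRational_ofPoly P)
  rwa [inv_inv, sub_add_cancel] at this

theorem ne_zero_of_not_isRational {f : LaurentSeries ℚ} (hf : ¬ IsRational f) : f ≠ 0 := by
  rintro rfl
  exact hf (by simpa only [ofPoly_zero] using isRational_ofPoly 0)

theorem sub_ofPoly_ne_zero {f : LaurentSeries ℚ} (hf : ¬ IsRational f) (P : ℚ[X]) :
    f - ofPoly P ≠ 0 := fun h =>
  hf (by rw [sub_eq_zero.1 h]; exact isRational_ofPoly P)

theorem completeQuotient_succ' (f : LaurentSeries ℚ) (k : ℕ) :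
    completeQuotient f (k + 1) = completeQuotient (completeQuotient f 1) k := by
  induction k with
  | zero => rfl
  | succ k ih => rw [completeQuotient, ih, ← completeQuotient]

theorem partialQuotient_succ' (f : LaurentSeries ℚ) (k : ℕ) :
    partialQuotient f (k + 1) = partialQuotient (completeQuotient f 1) k := by
  rw [partialQuotient, completeQuotient_succ', partialQuotient]

theorem not_isRational_completeQuotient {f : LaurentSeries ℚ} (hf : ¬ IsRational f) (k : ℕ) :
    ¬ IsRational (completeQuotient f k) := by
  induction k with
  | zero => exact hf
  | succ k ih => exact not_isRational_inv_sub ih _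

theorem order_completeQuotient_one {f : LaurentSeries ℚ} (hf : ¬ IsRational f) :
    (completeQuotient f 1).order < 0 := by
  have h := sub_ofPoly_ne_zero hf (polyPart f)
  change ((f - ofPoly (polyPart f))⁻¹).order < 0
  rw [order_inv h]
  have := order_sub_polyPart_pos h
  omega

theorem natDegree_partialQuotient_one {f : LaurentSeries ℚ} (hf : ¬ IsRational f) :
    ((partialQuotient f 1).natDegree : ℤ) = -(completeQuotient f 1).order :=
  order_polyPart (ne_zero_of_not_isRational (not_isRational_completeQuotient hf 1))
    (order_completeQuotient_one hf).le

theorem one_le_natDegree_partialQuotient {f : LaurentSeries ℚ} (hf : ¬ IsRational f) (k : ℕ) :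
    1 ≤ (partialQuotient f (k + 1)).natDegree := by
  induction k generalizing f with
  | zero =>
    have h1 := natDegree_partialQuotient_one hf
    have h2 := order_completeQuotient_one hf
    rw [zero_add]
    omega
  | succ k ih =>
    rw [partialQuotient_succ']
    exact ih (not_isRational_completeQuotient hf 1)

/-! ### Numerators and denominators of the convergents -/

/-- The numerator and the denominator of the continued fraction `[a_0, …, a_k]`. -/
noncomputable def continuants : (ℕ → ℚ[X]) → ℕ → ℚ[X] × ℚ[X]
  | a, 0 => (a 0, 1)
  | a, k + 1 => (a 0 * (continuants (fun i => a (i + 1)) k).1 +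
      (continuants (fun i => a (i + 1)) k).2, (continuants (fun i => a (i + 1)) k).1)

theorem isCoprime_continuants (a : ℕ → ℚ[X]) (k : ℕ) :
    IsCoprime (continuants a k).1 (continuants a k).2 := by
  induction k generalizing a with
  | zero => exact isCoprime_one_right
  | succ k ih =>
    rw [continuants, add_comm]
    exact (ih fun i => a (i + 1)).symm.add_mul_right_left (a 0)

/-- Prepending a partial quotient acts on both pairs by one matrix of determinant -1. Being a
nonzero constant, the determinant survives evaluation at any point, so consecutive convergents stay
distinct there. -/
theorem continuants_det (a : ℕ → ℚ[X]) (k : ℕ) :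
    (continuants a k).1 * (continuants a (k + 1)).2 -
      (continuants a (k + 1)).1 * (continuants a k).2 = (-1) ^ (k + 1) := by
  induction k generalizing a with
  | zero => simp [continuants]
  | succ k ih =>
    have := ih (fun i => a (i + 1))
    rw [pow_succ, ← this]
    conv_lhs => rw [continuants, continuants]
    ring

theorem degree_continuants (a : ℕ → ℚ[X]) (ha : ∀ i, 1 ≤ (a i).natDegree) (k : ℕ) :
    (continuants a k).1.natDegree = ∑ i ∈ Finset.range (k + 1), (a i).natDegree ∧
      (continuants a k).2.natDegree < (continuants a k).1.natDegree := by
  induction k generalizing a with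
  | zero => simpa [continuants] using Nat.succ_le_iff.1 (ha 0)
  | succ k ih =>
    obtain ⟨h1, h2⟩ := ih (fun i => a (i + 1)) (fun i => ha _)
    have h0 : (a 0) ≠ 0 := by rintro h; have := ha 0; simp [h] at this
    have hN : (continuants (fun i => a (i + 1)) k).1 ≠ 0 := by
      rintro h; simp [h] at h2
    have h3 : (continuants a (k + 1)).1.natDegree =
        (a 0).natDegree + (continuants (fun i => a (i + 1)) k).1.natDegree := by
      rw [continuants, ← natDegree_mul h0 hN]
      apply natDegree_add_eq_left_of_natDegree_lt
      rw [natDegree_mul h0 hN]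
      omega
    refine ⟨?_, ?_⟩
    · rw [h3, h1, Finset.sum_range_succ' _ (k + 1), add_comm]
    · rw [h3]
      have := ha 0
      simp only [continuants]
      omega

/-- The denominator is the numerator for the tail of the sequence, all of whose terms are
nonconstant; the term of index 0 may be constant and does not contribute. -/
theorem natDegree_continuants_snd {f : LaurentSeries ℚ} (hf : ¬ IsRational f) (k : ℕ) :
    (continuants (partialQuotient f) k).2.natDegree =
      ∑ i ∈ Finset.range k, (partialQuotient f (i + 1)).natDegree := by
  cases k with
  | zero => simp [continuants]
  | succ k => exact (degree_continuants _ (one_le_natDegree_partialQuotient hf) k).1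

theorem continuants_snd_ne_zero {f : LaurentSeries ℚ} (hf : ¬ IsRational f) (k : ℕ) :
    (continuants (partialQuotient f) k).2 ≠ 0 := by
  cases k with
  | zero => simp [continuants]
  | succ k =>
    intro h
    have h2 := (degree_continuants _ (one_le_natDegree_partialQuotient hf) k).2
    rw [continuants] at h
    simp only at h
    rw [h] at h2
    simp at h2

theorem contFract_eq_div (a : ℕ → ℚ[X]) (ha : ∀ i, 1 ≤ (a (i + 1)).natDegree) (k : ℕ) :
    contFract a k = algebraMap ℚ[X] (RatFunc ℚ) (continuants a k).1 /
      algebraMap ℚ[X] (RatFunc ℚ) (continuants a k).2 := by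
  induction k generalizing a with
  | zero => simp [contFract, continuants]
  | succ k ih =>
    rw [contFract, ih (fun i => a (i + 1)) (fun i => ha (i + 1)), continuants]
    have hN : (continuants (fun i => a (i + 1)) k).1 ≠ 0 := by
      have := (degree_continuants (fun i => a (i + 1)) ha k).2
      rintro h; simp [h] at this
    have hN' := RatFunc.algebraMap_ne_zero hN
    simp only [map_add, map_mul]
    rw [inv_div, add_div, mul_div_cancel_right₀ _ hN']

theorem natDegree_denom_div {p q : ℚ[X]} (hq : q ≠ 0) (h : IsCoprime p q) :
    (algebraMap ℚ[X] (RatFunc ℚ) p / algebraMap ℚ[X] (RatFunc ℚ) q).denom.natDegree =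
      q.natDegree := by
  set x := algebraMap ℚ[X] (RatFunc ℚ) p / algebraMap ℚ[X] (RatFunc ℚ) q with hx
  have h1 : x.denom ∣ q := RatFunc.denom_div_dvd p q
  have h2 : x.num * q = p * x.denom := (RatFunc.num_mul_eq_mul_denom_iff hq).2 hx
  have h3 : q ∣ x.denom := h.symm.dvd_of_dvd_mul_left ⟨x.num, by rw [← h2, mul_comm]⟩
  exact le_antisymm (natDegree_le_of_dvd h1 hq) (natDegree_le_of_dvd h3 x.denom_ne_zero)

theorem denDegree_eq {f : LaurentSeries ℚ} (hf : ¬ IsRational f) (k : ℕ) :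
    denDegree f k = (continuants (partialQuotient f) k).2.natDegree := by
  rw [denDegree, convergent, contFract_eq_div _ (one_le_natDegree_partialQuotient hf)]
  exact natDegree_denom_div (continuants_snd_ne_zero hf k) (isCoprime_continuants _ _)

theorem denDegree_strictMono {f : LaurentSeries ℚ} (hf : ¬ IsRational f) :
    StrictMono (denDegree f) := by
  apply strictMono_nat_of_lt_succ
  intro k
  rw [denDegree_eq hf, denDegree_eq hf, natDegree_continuants_snd hf,
    natDegree_continuants_snd hf, Finset.sum_range_succ]
  have := one_le_natDegree_partialQuotient hf k
  omega

/-- The remainder `q_k f - p_k` of the `k`-th convergent of `f`. -/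
noncomputable def remainder (f : LaurentSeries ℚ) (k : ℕ) : LaurentSeries ℚ :=
  ofPoly (continuants (partialQuotient f) k).2 * f - ofPoly (continuants (partialQuotient f) k).1

/-- With f = a_0 + 1/f_1 and (p, q) = (a_0 p' + q', p'), one has q f - p = p'/f_1 - q'. -/
theorem remainder_succ {f : LaurentSeries ℚ} (hf : ¬ IsRational f) (k : ℕ) :
    remainder f (k + 1) = -((completeQuotient f 1)⁻¹ * remainder (completeQuotient f 1) k) := by
  have h1 : (fun i => partialQuotient f (i + 1)) = partialQuotient (completeQuotient f 1) :=
    funext fun i => partialQuotient_succ' f i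
  have hg : completeQuotient f 1 ≠ 0 :=
    ne_zero_of_not_isRational (not_isRational_completeQuotient hf 1)
  have h2 : f = ofPoly (partialQuotient f 0) + (completeQuotient f 1)⁻¹ := by
    change f = ofPoly (polyPart f) + ((f - ofPoly (polyPart f))⁻¹)⁻¹
    rw [inv_inv, add_sub_cancel]
  rw [remainder, remainder, continuants, h1]
  simp only [ofPoly_add, ofPoly_mul]
  rw [mul_sub, mul_comm (ofPoly _) (completeQuotient f 1), inv_mul_cancel_left₀ hg]
  nth_rw 2 [h2]
  ring

/-- Each passage to the tail contributes the order of 1/f_1, which is the degree of a_1; these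
degrees add up to that of the next denominator. -/
theorem remainder_ne_zero_and_order {f : LaurentSeries ℚ} (hf : ¬ IsRational f) (k : ℕ) :
    remainder f k ≠ 0 ∧ (remainder f k).order = denDegree f (k + 1) := by
  rw [denDegree_eq hf, natDegree_continuants_snd hf]
  induction k generalizing f with
  | zero =>
    have h : remainder f 0 = (completeQuotient f 1)⁻¹ := by
      change _ = ((f - ofPoly (polyPart f))⁻¹)⁻¹
      simp [remainder, continuants, partialQuotient, completeQuotient, ofPoly_one]
    have hg : completeQuotient f 1 ≠ 0 :=
      ne_zero_of_not_isRational (not_isRational_completeQuotient hf 1)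
    rw [h]
    refine ⟨inv_ne_zero hg, ?_⟩
    rw [order_inv hg, ← natDegree_partialQuotient_one hf]
    simp
  | succ k ih =>
    have hg := not_isRational_completeQuotient hf 1
    have hg0 := ne_zero_of_not_isRational hg
    obtain ⟨h1, h2⟩ := ih hg
    rw [remainder_succ hf]
    refine ⟨neg_ne_zero.2 (mul_ne_zero (inv_ne_zero hg0) h1), ?_⟩
    rw [HahnSeries.order_neg, HahnSeries.order_mul (inv_ne_zero hg0) h1, h2, order_inv hg0,
      ← natDegree_partialQuotient_one hf, Finset.sum_range_succ' _ (k + 1)]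
    simp only [← partialQuotient_succ']
    push_cast
    ring

/-! ### Values of convergent Laurent series -/

/-- The Laurent series `f` converges at `x`, with sum `s`. -/
def HasValue (f : LaurentSeries ℚ) (x s : ℝ) : Prop :=
  HasSum (fun n : ℤ => (f.coeff n : ℝ) * x ^ (-n)) s

theorem HasValue.unique {f : LaurentSeries ℚ} {x s t : ℝ} (h : HasValue f x s)
    (h' : HasValue f x t) : s = t :=
  HasSum.unique h h'

theorem HasValue.add {f g : LaurentSeries ℚ} {x s t : ℝ} (hf : HasValue f x s)
    (hg : HasValue g x t) : HasValue (f + g) x (s + t) := by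
  refine (HasSum.add hf hg).congr_fun ?_
  intro n
  simp [add_mul]

theorem HasValue.sub {f g : LaurentSeries ℚ} {x s t : ℝ} (hf : HasValue f x s)
    (hg : HasValue g x t) : HasValue (f - g) x (s - t) := by
  refine (HasSum.sub hf hg).congr_fun ?_
  intro n
  simp [sub_mul]

theorem HasValue.ofPoly_mul {f : LaurentSeries ℚ} {x s : ℝ} (hx : x ≠ 0) (hf : HasValue f x s)
    (P : ℚ[X]) : HasValue (ofPoly P * f) x (aeval x P * s) := by
  induction P using Polynomial.induction_on' with
  | add p q hp hq =>
    rw [ofPoly_add, add_mul, map_add, add_mul]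
    exact hp.add hq
  | monomial i a =>
    rw [ofPoly_monomial, aeval_monomial]
    have h := ((Equiv.addRight (i : ℤ)).hasSum_iff.2 hf).mul_left ((a : ℝ) * x ^ i)
    refine h.congr_fun ?_
    intro n
    have h1 : x ^ (-n) = x ^ (i : ℤ) * x ^ (-(n + (i : ℤ))) := by
      rw [← zpow_add₀ hx]; congr 1; ring
    rw [HahnSeries.coeff_single_mul, sub_neg_eq_add, h1]
    simp only [Function.comp, Equiv.coe_addRight, zpow_natCast]
    push_cast
    ring

theorem hasValue_one (x : ℝ) : HasValue 1 x 1 := by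
  have h := hasSum_single (f := fun n : ℤ => (((1 : LaurentSeries ℚ).coeff n : ℚ) : ℝ) * x ^ (-n)) 0
    (fun n hn => by simp [HahnSeries.coeff_one, hn])
  simpa [HasValue] using h

theorem hasValue_ofPoly {x : ℝ} (hx : x ≠ 0) (P : ℚ[X]) : HasValue (ofPoly P) x (aeval x P) := by
  simpa using (hasValue_one x).ofPoly_mul hx P

theorem HasValue.substPow {f : LaurentSeries ℚ} {d : ℕ} {x s : ℝ} (hd : 1 ≤ d)
    (hf : HasValue f (x ^ d) s) : HasValue (substPow d hd f) x s := by
  refine ((mulEmb d hd).injective.hasSum_iff ?_).1 (hf.congr_fun ?_)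
  · intro n hn
    rw [Mahler.substPow, HahnSeries.embDomain_of_notMem_range hn]
    simp
  · intro n
    simp only [Function.comp, Mahler.substPow, HahnSeries.embDomain_coeff]
    have : mulEmb d hd n = (d : ℤ) * n := rfl
    rw [this, ← zpow_natCast x d, ← zpow_mul, mul_neg]

theorem summable_of_mem_disc {f : LaurentSeries ℚ} {x : ℝ} (hx : x ∈ discOfConvergence f) :
    Summable (fun n : ℤ => (f.coeff n : ℝ) * x ^ (-n)) := by
  obtain ⟨-, h⟩ := hx
  have h1 := FormalMultilinearSeries.summable_norm_mul_pow _ h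
  refine Summable.of_nat_of_neg_add_one ?_ ?_
  · apply Summable.of_norm
    refine h1.congr ?_
    intro n
    rw [FormalMultilinearSeries.ofScalars_norm, norm_mul, Real.coe_toNNReal _ (by positivity)]
    simp
  · apply summable_of_ne_finset_zero (s := Finset.range (-f.order).toNat)
    intro n hn
    rw [Finset.mem_range] at hn
    rw [HahnSeries.coeff_eq_zero_of_lt_order (by omega)]
    simp

theorem discOfConvergence_mono {f : LaurentSeries ℚ} {x y : ℝ} (hx : x ∈ discOfConvergence f)
    (hxy : |x| ≤ |y|) : y ∈ discOfConvergence f := by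
  obtain ⟨h0, h⟩ := hx
  have hx0 := abs_pos.2 h0
  refine ⟨abs_pos.1 (hx0.trans_le hxy), lt_of_le_of_lt ?_ h⟩
  exact ENNReal.ofReal_le_ofReal (inv_anti₀ hx0 hxy)

theorem hasValue_of_mem_disc {f : LaurentSeries ℚ} {x : ℝ} (hx : x ∈ discOfConvergence f) :
    HasValue f x (value f x) :=
  (summable_of_mem_disc hx).hasSum

/-- As `x → ∞`, the value of `g` at `x` is asymptotic to its leading term. -/
theorem tendsto_leadingCoeff {g : LaurentSeries ℚ} {x₀ : ℝ} {x v : ℕ → ℝ} (hx₀ : x₀ ≠ 0)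
    (hs : Summable (fun n : ℤ => (g.coeff n : ℝ) * x₀ ^ (-n))) (hle : ∀ m, |x₀| ≤ |x m|)
    (hx : Tendsto (fun m => |x m|) atTop atTop) (hv : ∀ m, HasValue g (x m) (v m)) :
    Tendsto (fun m => x m ^ g.order * v m) atTop (nhds (g.coeff g.order : ℝ)) := by
  have hpos := abs_pos.2 hx₀
  have hxm : ∀ m, x m ≠ 0 := fun m => abs_pos.1 (hpos.trans_le (hle m))
  have hv' : ∀ m, x m ^ g.order * v m =
      ∑' n : ℤ, (g.coeff n : ℝ) * x m ^ (g.order - n) := by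
    intro m
    rw [← HasSum.tsum_eq ((hv m).mul_left (x m ^ g.order))]
    congr 1; ext n
    rw [sub_eq_add_neg, zpow_add₀ (hxm m)]; ring
  simp only [hv']
  have hlim : (g.coeff g.order : ℝ) =
      ∑' n : ℤ, if n = g.order then (g.coeff g.order : ℝ) else 0 := by
    rw [tsum_ite_eq]
  rw [hlim]
  -- Terms below the order vanish. For n at least the order, the exponent `g.order - n` is
  -- nonpositive, so the term at `x₀` dominates the one at `x m`.
  refine tendsto_tsum_of_dominated_convergence
    (bound := fun n => |x₀| ^ g.order * |(g.coeff n : ℝ) * x₀ ^ (-n)|) (hs.abs.mul_left _) ?_ ?_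
  · intro n
    rcases lt_trichotomy n g.order with h | h | h
    · simp [HahnSeries.coeff_eq_zero_of_lt_order h, h.ne]
    · subst h; simp
    · rw [if_neg h.ne']
      have h1 : Tendsto (fun m => |x m| ^ (g.order - n)) atTop (nhds 0) := by
        have h2 : g.order - n = -(((n - g.order).toNat : ℕ) : ℤ) := by omega
        rw [h2]
        refine (tendsto_pow_neg_atTop (𝕜 := ℝ) (n := (n - g.order).toNat) (by omega)).comp hx
      rw [tendsto_zero_iff_norm_tendsto_zero]
      simp only [norm_mul, norm_zpow, Real.norm_eq_abs]
      simpa using h1.const_mul |(g.coeff n : ℝ)|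
  · refine Eventually.of_forall fun m n => ?_
    rcases lt_or_ge n g.order with h | h
    · simp [HahnSeries.coeff_eq_zero_of_lt_order h]
    · rw [norm_mul, norm_zpow, Real.norm_eq_abs, Real.norm_eq_abs, abs_mul, abs_zpow,
        mul_left_comm, ← zpow_add₀ hpos.ne', ← sub_eq_add_neg]
      refine mul_le_mul_of_nonneg_left ?_ (abs_nonneg _)
      have h2 : g.order - n = -(((n - g.order).toNat : ℕ) : ℤ) := by omega
      rw [h2, zpow_neg, zpow_neg, zpow_natCast, zpow_natCast]
      exact inv_anti₀ (by positivity) (pow_le_pow_left₀ hpos.le (hle m) _)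

/-- A nonzero convergent Laurent series is eventually nonzero and of the order of its
leading term. -/
theorem eventually_ne_zero_and_le {g : LaurentSeries ℚ} (hg : g ≠ 0) {x₀ : ℝ} {x v : ℕ → ℝ}
    (hx₀ : x₀ ≠ 0) (hs : Summable (fun n : ℤ => (g.coeff n : ℝ) * x₀ ^ (-n)))
    (hle : ∀ m, |x₀| ≤ |x m|) (hx : Tendsto (fun m => |x m|) atTop atTop)
    (hv : ∀ m, HasValue g (x m) (v m)) (K : ℝ) :
    ∀ᶠ m in atTop, v m ≠ 0 ∧ K * |v m| ≤ |x m| ^ (1 - g.order) := by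
  have h := tendsto_leadingCoeff hx₀ hs hle hx hv
  have hc : (g.coeff g.order : ℝ) ≠ 0 := by
    exact_mod_cast HahnSeries.coeff_order_eq_zero.not.2 hg
  have h1 := h.eventually_ne hc
  have h2 := (h.abs.const_mul |K|).eventually_lt_const (lt_add_one _)
  -- The spare factor |x m| in the target absorbs both K and the leading coefficient.
  filter_upwards [h1, h2, hx.eventually_ge_atTop (|K| * |(g.coeff g.order : ℝ)| + 1)]
    with m hm1 hm2 hm3
  refine ⟨right_ne_zero_of_mul hm1, ?_⟩
  have hpos := (abs_pos.2 hx₀).trans_le (hle m)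
  rw [zpow_sub₀ hpos.ne', zpow_one, le_div_iff₀ (zpow_pos hpos _)]
  rw [abs_mul, abs_zpow] at hm2
  have h3 : K * |v m| ≤ |K| * |v m| := mul_le_mul_of_nonneg_right (le_abs_self K) (abs_nonneg _)
  have h4 := mul_le_mul_of_nonneg_right h3 (zpow_pos hpos g.order).le
  linarith [hm2, h4, hm3]

/-! ### Iterating the functional equation -/

theorem value_functional_equation {d : ℕ} {hd : 1 ≤ d} {A B : ℚ[X]} (hB : B ≠ 0)
    {f : LaurentSeries ℚ} (hf : f = ofPoly A / ofPoly B * substPow d hd f) {x : ℝ}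
    (hx : x ∈ discOfConvergence f) (hxd : x ^ d ∈ discOfConvergence f) :
    aeval x B * value f x = aeval x A * value f (x ^ d) := by
  have h1 := (hasValue_of_mem_disc hx).ofPoly_mul hx.1 B
  have h2 := (HasValue.substPow hd (hasValue_of_mem_disc hxd)).ofPoly_mul hx.1 A
  have h3 : ofPoly B * f = ofPoly A * substPow d hd f := by
    have h0 := ofPoly_ne_zero hB
    conv_lhs => rw [hf]
    field_simp
  rw [h3] at h1
  exact h1.unique h2

theorem value_iterate {d : ℕ} {hd : 1 ≤ d} {A B : ℚ[X]} (hB : B ≠ 0)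
    {f : LaurentSeries ℚ} (hf : f = ofPoly A / ofPoly B * substPow d hd f) {x : ℝ}
    (hx : ∀ m : ℕ, x ^ d ^ m ∈ discOfConvergence f) (m : ℕ) :
    (∏ t ∈ Finset.range m, aeval (x ^ d ^ t) B) * value f x =
      (∏ t ∈ Finset.range m, aeval (x ^ d ^ t) A) * value f (x ^ d ^ m) := by
  induction m with
  | zero => simp
  | succ m ih =>
    have hxd : (x ^ d ^ m) ^ d = x ^ d ^ (m + 1) := by rw [← pow_mul, pow_succ]
    have h := value_functional_equation hB hf (hx m) (by rw [hxd]; exact hx _)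
    rw [hxd] at h
    rw [Finset.prod_range_succ, Finset.prod_range_succ, mul_right_comm, ih, mul_right_comm,
      mul_assoc _ (aeval _ A), ← h]
    ring

/-- Because |x| ≥ 2, constant factors can be absorbed into the exponent. -/
theorem exists_abs_aeval_le_pow (P : ℚ[X]) :
    ∃ C : ℕ, ∀ x : ℝ, 2 ≤ |x| → |aeval x P| ≤ |x| ^ C := by
  induction P using Polynomial.induction_on' with
  | add p q hp hq =>
    obtain ⟨C, hC⟩ := hp
    obtain ⟨C', hC'⟩ := hq
    refine ⟨max C C' + 1, fun x hx => ?_⟩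
    have h1 := pow_le_pow_right₀ (by linarith : 1 ≤ |x|) (le_max_left C C')
    have h2 := pow_le_pow_right₀ (by linarith : 1 ≤ |x|) (le_max_right C C')
    have h3 : 0 ≤ |x| ^ max C C' := by positivity
    rw [map_add, pow_succ]
    nlinarith [abs_add_le (aeval x p) (aeval x q), hC x hx, hC' x hx]
  | monomial i a =>
    obtain ⟨s, hs⟩ := pow_unbounded_of_one_lt |(a : ℝ)| one_lt_two
    refine ⟨s + i, fun x hx => ?_⟩
    rw [aeval_monomial, abs_mul, abs_pow, pow_add]
    refine mul_le_mul_of_nonneg_right ?_ (by positivity)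
    exact hs.le.trans (pow_le_pow_left₀ (by norm_num) hx s)

theorem exists_abs_prod_aeval_le (P : ℚ[X]) {d : ℕ} (hd : 2 ≤ d) {x : ℝ} (hx : 2 ≤ |x|) :
    ∃ C : ℕ, ∀ m : ℕ, |∏ t ∈ Finset.range m, aeval (x ^ d ^ t) P| ≤ (|x| ^ d ^ m) ^ C := by
  obtain ⟨C, hC⟩ := exists_abs_aeval_le_pow P
  refine ⟨C, fun m => ?_⟩
  induction m with
  | zero => simpa using one_le_pow₀ (by linarith)
  | succ m ih =>
    have h1 : 1 ≤ |x| := by linarith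
    have h2 : 2 ≤ |x ^ d ^ m| := by
      rw [abs_pow]
      exact hx.trans (le_self_pow₀ h1 (by positivity))
    have h3 := hC _ h2
    rw [abs_pow] at h3
    rw [Finset.prod_range_succ, abs_mul]
    refine (mul_le_mul ih h3 (abs_nonneg _) (by positivity)).trans ?_
    rw [← mul_pow, ← pow_add]
    -- The same C persists through the induction because 2 d^m ≤ d^(m+1).
    refine pow_le_pow_left₀ (by positivity) (pow_le_pow_right₀ h1 ?_) _
    rw [pow_succ]
    nlinarith [Nat.zero_le (d ^ m)]

/-! ### Clearing denominators -/

theorem exists_int_mul_aeval (P : ℚ[X]) :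
    ∃ N : ℤ, N ≠ 0 ∧ ∀ y : ℤ, ∃ u : ℤ, (u : ℝ) = N * aeval (y : ℝ) P := by
  obtain ⟨N, hN, h⟩ := IsLocalization.integerNormalization_spec (nonZeroDivisors ℤ) P
  refine ⟨N, nonZeroDivisors.ne_zero hN, fun y =>
    ⟨(IsLocalization.integerNormalization (nonZeroDivisors ℤ) P).eval y, ?_⟩⟩
  have h1 := congrArg (aeval (y : ℝ)) h
  rw [aeval_map_algebraMap, map_zsmul, zsmul_eq_mul] at h1
  rw [← h1]
  simpa using (aeval_algebraMap_apply ℝ y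
    (IsLocalization.integerNormalization (nonZeroDivisors ℤ) P)).symm

/-- A multiplier common to both polynomials leaves the quotient of their values unchanged. -/
theorem exists_int_mul_aeval_pair (P Q : ℚ[X]) :
    ∃ N : ℤ, N ≠ 0 ∧ ∀ y : ℤ, (∃ u : ℤ, (u : ℝ) = N * aeval (y : ℝ) P) ∧
      ∃ u : ℤ, (u : ℝ) = N * aeval (y : ℝ) Q := by
  obtain ⟨N, hN, h⟩ := exists_int_mul_aeval P
  obtain ⟨N', hN', h'⟩ := exists_int_mul_aeval Q
  refine ⟨N * N', mul_ne_zero hN hN', fun y => ⟨?_, ?_⟩⟩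
  · obtain ⟨u, hu⟩ := h y
    exact ⟨u * N', by push_cast; rw [hu]; ring⟩
  · obtain ⟨u, hu⟩ := h' y
    exact ⟨u * N, by push_cast; rw [hu]; ring⟩

/-! ### Irrationality exponents from dense families of approximations -/

theorem finite_rat_den_lt (ξ : ℝ) (N : ℕ) : {x : ℚ | x.den < N ∧ |ξ - (x : ℝ)| ≤ 1}.Finite := by
  set M : ℤ := ⌈(|ξ| + 1) * N⌉
  refine (((Set.finite_Icc (-M) M).prod (Set.finite_Iio N)).image
    fun a : ℤ × ℕ => (a.1 / a.2 : ℚ)).subset ?_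
  rintro x ⟨h1, h2⟩
  refine ⟨(x.num, x.den), ⟨?_, h1⟩, Rat.num_div_den x⟩
  have h3 : |(x.num : ℝ)| ≤ (|ξ| + 1) * N := by
    have h4 : (x.num : ℝ) = x * x.den := by exact_mod_cast (Rat.mul_den_eq_num x).symm
    have h5 : |(x : ℝ)| ≤ |ξ| + 1 := by
      have := abs_sub_abs_le_abs_sub (x : ℝ) ξ
      rw [abs_sub_comm] at this
      linarith
    have h6 : (x.den : ℝ) ≤ N := by exact_mod_cast h1.le
    rw [h4, abs_mul, Nat.abs_cast]
    exact mul_le_mul h5 h6 (by positivity) (by positivity)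
  have h4 : |x.num| ≤ M := by
    have := h3.trans (Int.le_ceil _)
    exact_mod_cast this
  exact abs_le.1 h4

/-- The nonzero integer Q·num - P·den equals den·(Qξ - P) - den·Q·(ξ - x). The first summand is at
most 1/2 in absolute value, so the second is at least 1/2. -/
theorem one_le_of_ne {ξ : ℝ} {x : ℚ} {P Q : ℤ} (hne : P * x.den ≠ Q * x.num)
    (h : (x.den : ℝ) * |Q * ξ - P| ≤ 1 / 2) : 1 ≤ 2 * x.den * |(Q : ℝ)| * |ξ - x| := by
  have hden : (0 : ℝ) < x.den := by exact_mod_cast x.den_pos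
  have h1 : (1 : ℝ) ≤ |(Q : ℝ) * x.num - P * x.den| := by
    have : 1 ≤ |Q * x.num - P * x.den| := Int.one_le_abs (sub_ne_zero.2 hne.symm)
    exact_mod_cast this
  have h4 : (x.num : ℝ) = x * x.den := by exact_mod_cast (Rat.mul_den_eq_num x).symm
  have h2 : (Q : ℝ) * x.num - P * x.den = x.den * (Q * ξ - P) - x.den * (Q * (ξ - x)) := by
    rw [h4]; ring
  rw [h2] at h1
  have h3 := h1.trans (abs_sub _ _)
  rw [abs_mul, abs_mul, abs_mul, Nat.abs_cast] at h3
  linarith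

theorem tendsto_pow_pow {c : ℝ} (hc : 2 ≤ c) {d : ℕ} (hd : 2 ≤ d) :
    Tendsto (fun m => c ^ d ^ m) atTop atTop :=
  (tendsto_pow_atTop_atTop_of_one_lt (by linarith)).comp
    (tendsto_pow_atTop_atTop_of_one_lt (by omega))

/-- The last hypothesis compares |Qξ - P| ≤ X^(C - s) with |Q|^(1 - μ) ≥ X^(-(μ - 1)(r + C)). The
fractions tend to ξ without ever equalling it, so they cannot all lie in a finite set. -/
theorem infinite_of_approximations {ξ c : ℝ} (hc : 2 ≤ c) {d : ℕ} (hd : 2 ≤ d) {C μ r s : ℝ}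
    {P Q : ℕ → ℤ} (hQ0 : ∀ᶠ m in atTop, Q m ≠ 0)
    (hQ : ∀ᶠ m in atTop, |(Q m : ℝ)| ≤ (c ^ d ^ m) ^ (r + C))
    (hR0 : ∀ᶠ m in atTop, Q m * ξ - P m ≠ 0)
    (hR : ∀ᶠ m in atTop, |Q m * ξ - P m| ≤ (c ^ d ^ m) ^ (C - s))
    (hC : 0 ≤ C) (hr : 0 ≤ r) (hμ : 1 ≤ μ) (h : (μ - 1) * (r + C) + C < s) :
    {x : ℚ | |ξ - (x : ℝ)| < (x.den : ℝ) ^ (-μ)}.Infinite := by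
  intro hfin
  have hX := tendsto_pow_pow hc hd
  have hs : 0 < s - C := by
    have := mul_nonneg (sub_nonneg.2 hμ) (add_nonneg hr hC)
    linarith
  have hdist : ∀ᶠ m in atTop, |ξ - ((P m / Q m : ℚ) : ℝ)| = |Q m * ξ - P m| / |(Q m : ℝ)| := by
    filter_upwards [hQ0] with m hm
    have hm' : (Q m : ℝ) ≠ 0 := by exact_mod_cast hm
    rw [← abs_div]
    push_cast
    congr 1
    field_simp
  have hQ1 : ∀ᶠ m in atTop, 1 ≤ |(Q m : ℝ)| := by
    filter_upwards [hQ0] with m hm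
    exact_mod_cast Int.one_le_abs hm
  have htend : Tendsto (fun m => ((P m / Q m : ℚ) : ℝ)) atTop (nhds ξ) := by
    rw [tendsto_iff_dist_tendsto_zero]
    have h0 : Tendsto (fun m => (c ^ d ^ m) ^ (C - s)) atTop (nhds 0) := by
      have := (tendsto_rpow_neg_atTop hs).comp hX
      simpa only [neg_sub, Function.comp_def] using this
    refine squeeze_zero' (Eventually.of_forall fun _ => dist_nonneg) ?_ h0
    filter_upwards [hdist, hQ1, hR] with m h1 h2 h3
    rw [dist_comm, Real.dist_eq, h1]
    exact (div_le_self (abs_nonneg _) h2).trans h3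
  have hopen : ∀ᶠ y in nhds ξ,
      y ∉ ((fun x : ℚ => (x : ℝ)) '' {x : ℚ | |ξ - (x : ℝ)| < (x.den : ℝ) ^ (-μ)}) \ {ξ} :=
    ((hfin.image _).subset Set.sdiff_subset).isClosed.isOpen_compl.mem_nhds (by simp)
  obtain ⟨m, hm, hd1, hq0, hq1, hq, hr0, hr1, hX1⟩ := ((htend.eventually hopen).and
    (hdist.and (hQ0.and (hQ1.and (hQ.and (hR0.and (hR.and (hX.eventually_gt_atTop 1)))))))).exists
  have hqpos : 0 < |(Q m : ℝ)| := by linarith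
  apply hm
  refine ⟨⟨_, ?_, rfl⟩, ?_⟩
  · rw [Set.mem_ofPred_eq, hd1]
    have hden : (((P m / Q m : ℚ).den : ℕ) : ℝ) ≤ |(Q m : ℝ)| := by
      have h1 : ((P m / Q m : ℚ).den : ℤ) ∣ Q m := by
        rw [← Rat.divInt_eq_div]
        exact Rat.den_dvd _ _
      have h2 : ((P m / Q m : ℚ).den : ℤ) ≤ |Q m| :=
        Int.le_of_dvd (abs_pos.2 hq0) ((dvd_abs _ _).2 h1)
      exact_mod_cast h2
    have hden0 : (0 : ℝ) < ((P m / Q m : ℚ).den : ℕ) := by exact_mod_cast Rat.den_pos _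
    refine lt_of_lt_of_le ?_ (Real.rpow_le_rpow_of_nonpos hden0 hden (by linarith))
    rw [div_lt_iff₀ hqpos, ← Real.rpow_add_one hqpos.ne']
    have h2 := Real.rpow_le_rpow_of_nonpos hqpos hq (by linarith : -μ + 1 ≤ 0)
    rw [← Real.rpow_mul (by positivity)] at h2
    refine hr1.trans_lt (lt_of_lt_of_le (Real.rpow_lt_rpow_of_exponent_lt hX1 ?_) h2)
    linarith
  · intro h1
    rw [Set.mem_singleton_iff] at h1
    rw [h1, sub_self, abs_zero, eq_comm, div_eq_zero_iff] at hd1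
    rcases hd1 with h2 | h2
    · exact hr0 (abs_eq_zero.1 h2)
    · exact hqpos.ne' h2

theorem finite_of_approximations {ξ c : ℝ} (hc : 2 ≤ c) {d : ℕ} (hd : 2 ≤ d) {δ : ℕ → ℕ}
    (hδ : StrictMono δ) {C : ℝ} (hC : 0 ≤ C) {P Q : ℕ → ℕ → ℤ}
    (hQ : ∀ k, ∀ᶠ m in atTop, |(Q k m : ℝ)| ≤ (c ^ d ^ m) ^ (δ k + C))
    (hR : ∀ k, ∀ᶠ m in atTop, |Q k m * ξ - P k m| ≤ (c ^ d ^ m) ^ (C - δ (k + 1)))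
    (hdet : ∀ k, ∀ᶠ m in atTop, P k m * Q (k + 1) m ≠ P (k + 1) m * Q k m)
    {ℓ μ : ℝ} (hℓ : 0 ≤ ℓ) (hμ : ℓ < μ - 1) (hlim : ∀ᶠ k in atTop, (δ (k + 1) : ℝ) ≤ ℓ * δ k) :
    {x : ℚ | |ξ - (x : ℝ)| < (x.den : ℝ) ^ (-μ)}.Finite := by
  obtain ⟨K, hK⟩ := eventually_atTop.1 hlim
  -- The first entry forces the index k chosen below to be at least K; the second makes (μ - 1 -
  -- ℓ)·t absorb the loss (1 + ℓ)(C + 1) in `hdelta`.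
  set D : ℝ := max ((δ K : ℝ) + 1) ((1 + ℓ) * (C + 1) / (μ - 1 - ℓ))
  have hD1 : (δ K : ℝ) + 1 ≤ D := le_max_left _ _
  have hD2 : (1 + ℓ) * (C + 1) ≤ (μ - 1 - ℓ) * D := by
    rw [← div_le_iff₀' (by linarith)]
    exact le_max_right _ _
  have hDpos : 0 < D := by positivity
  -- This bounds every k that can occur, since k ≤ δ k ≤ t + C + 1 with t < d·D. Indices up to k + 1
  -- are needed, hence `K' + 2`.
  set K' : ℕ := ⌈d * D + (C + 1)⌉₊
  have hall : ∀ᶠ m in atTop, ∀ k ∈ Finset.range (K' + 2),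
      |(Q k m : ℝ)| ≤ (c ^ d ^ m) ^ (δ k + C) ∧
      |Q k m * ξ - P k m| ≤ (c ^ d ^ m) ^ (C - δ (k + 1)) ∧
      P k m * Q (k + 1) m ≠ P (k + 1) m * Q k m :=
    (Finset.eventually_all _).2 fun k _ => (hQ k).and ((hR k).and (hdet k))
  obtain ⟨m₀, hm₀⟩ := eventually_atTop.1 hall
  obtain ⟨N, hN⟩ := exists_nat_ge (c ^ ((d : ℝ) ^ m₀ * D))
  refine (finite_rat_den_lt ξ N).subset fun x hx => ?_
  rw [Set.mem_ofPred_eq] at hx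
  have hc0 : 0 < c := by linarith
  have hden : (1 : ℝ) ≤ x.den := by exact_mod_cast x.den_pos
  refine ⟨?_, hx.le.trans (Real.rpow_le_one_of_one_le_of_nonpos hden (by linarith))⟩
  by_contra! hNx
  have hd0 : (0 : ℝ) < d := by exact_mod_cast (by omega : 0 < d)
  have hd1 : (1 : ℝ) < d := by exact_mod_cast (by omega : 1 < d)
  -- the scale of the denominator
  set y : ℝ := Real.logb c x.den
  have hy : c ^ y = x.den := Real.rpow_logb hc0 (by linarith) (by linarith)
  have hy1 : (d : ℝ) ^ m₀ * D ≤ y := by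
    rw [Real.le_logb_iff_rpow_le (by linarith) (by linarith)]
    exact hN.trans (by exact_mod_cast hNx)
  have hy2 : (d : ℝ) ^ m₀ ≤ y / D := (le_div_iff₀ hDpos).2 hy1
  -- Choosing m so that d^m ≤ y/D < d^(m+1) puts the exponent t, defined by `x.den` = X^t, in the
  -- fixed window [D, d·D).
  obtain ⟨m, hm1, hm2⟩ := exists_nat_pow_near ((one_le_pow₀ hd1.le).trans hy2) hd1
  have hmm : m₀ ≤ m := by
    have := (pow_lt_pow_iff_right₀ hd1).1 (hy2.trans_lt hm2)
    omega
  have hdm : (0 : ℝ) < (d : ℝ) ^ m := by positivity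
  set t : ℝ := y / (d : ℝ) ^ m
  have ht1 : D ≤ t := by
    rw [le_div_iff₀ hdm, mul_comm]
    exact (le_div_iff₀ hDpos).1 hm1
  have ht2 : t < d * D := by
    rw [div_lt_iff₀ hdm]
    rw [div_lt_iff₀ hDpos, pow_succ] at hm2
    linarith
  set X : ℝ := c ^ d ^ m
  have hX2 : 2 ≤ X := hc.trans (le_self_pow₀ (by linarith) (by positivity))
  have hX0 : 0 < X := by linarith
  have hXt : X ^ t = x.den := by
    rw [← hy, show X = c ^ ((d ^ m : ℕ) : ℝ) from (Real.rpow_natCast _ _).symm,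
      ← Real.rpow_mul hc0.le]
    congr 1
    push_cast
    exact mul_div_cancel₀ _ hdm.ne'
  -- the choice of the convergent
  have hex : ∃ n, t + (C + 1) < δ n := by
    obtain ⟨n, hn⟩ := exists_nat_gt (t + (C + 1))
    exact ⟨n, hn.trans_le (by exact_mod_cast hδ.le_apply)⟩
  classical
  obtain ⟨k, hk⟩ : ∃ k, Nat.find hex = k + 1 := by
    refine Nat.exists_eq_succ_of_ne_zero fun h0 => ?_
    have h1 := Nat.find_spec hex
    rw [h0] at h1
    have h2 : (δ 0 : ℝ) ≤ δ K := by exact_mod_cast hδ.monotone (Nat.zero_le K)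
    linarith
  have hk1 : t + (C + 1) < δ (k + 1) := hk ▸ Nat.find_spec hex
  have hk2 : (δ k : ℝ) ≤ t + (C + 1) := not_lt.1 (Nat.find_min hex (by omega : k < Nat.find hex))
  have hKk : K ≤ k := by
    by_contra! h
    have : (δ (k + 1) : ℝ) ≤ δ K := by exact_mod_cast hδ.monotone h
    linarith
  have hkK' : k ≤ K' := by
    have h1 : (k : ℝ) ≤ δ k := by exact_mod_cast hδ.le_apply
    have h2 : (k : ℝ) ≤ K' := by linarith [Nat.le_ceil (d * D + (C + 1))]
    exact_mod_cast h2
  have hdelta : (δ (k + 1) : ℝ) + C + 1 ≤ (μ - 1) * t := by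
    have h1 := hK k hKk
    have h2 := mul_le_mul_of_nonneg_left hk2 hℓ
    have h3 := mul_le_mul_of_nonneg_left ht1 (by linarith : 0 ≤ μ - 1 - ℓ)
    linarith
  -- a nearby approximation different from `x` gives a contradiction
  have key : ∀ j, k ≤ j → j ≤ k + 1 → P j m * x.den = Q j m * x.num := by
    intro j hj1 hj2
    by_contra hne
    obtain ⟨hq, hr, -⟩ := hm₀ m hmm j (Finset.mem_range.2 (by omega))
    have hX1 : 1 ≤ X := by linarith
    have h1 : (δ (k + 1) : ℝ) ≤ δ (j + 1) := by exact_mod_cast hδ.monotone (by omega)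
    have h2 : (δ j : ℝ) ≤ δ (k + 1) := by exact_mod_cast hδ.monotone (by omega)
    have h3 : (x.den : ℝ) * |Q j m * ξ - P j m| ≤ 1 / 2 := by
      calc (x.den : ℝ) * |Q j m * ξ - P j m| ≤ X ^ t * X ^ (C - δ (j + 1)) := by
            rw [hXt]; exact mul_le_mul_of_nonneg_left hr (by positivity)
        _ = X ^ (t + (C - δ (j + 1))) := (Real.rpow_add hX0 _ _).symm
        _ ≤ X ^ (-1 : ℝ) := Real.rpow_le_rpow_of_exponent_le hX1 (by linarith)
        _ ≤ 1 / 2 := by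
            rw [Real.rpow_neg_one, one_div]
            exact inv_anti₀ (by norm_num) hX2
    have h4 := one_le_of_ne hne h3
    have h5 : 2 * (x.den : ℝ) * |(Q j m : ℝ)| * |ξ - x| < 1 := by
      have hpos : 0 < 2 * (x.den : ℝ) * |(Q j m : ℝ)| := by
        by_contra! h0
        have := mul_nonpos_of_nonpos_of_nonneg h0 (abs_nonneg (ξ - x))
        linarith
      calc 2 * (x.den : ℝ) * |(Q j m : ℝ)| * |ξ - x|
          < 2 * (x.den : ℝ) * |(Q j m : ℝ)| * (x.den : ℝ) ^ (-μ) := mul_lt_mul_of_pos_left hx hpos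
        _ ≤ X * X ^ t * X ^ (δ j + C) * (X ^ t) ^ (-μ) := by
            rw [hXt]
            gcongr
        _ = X ^ (1 + t + (δ j + C) + t * -μ) := by
            rw [← Real.rpow_mul hX0.le, Real.rpow_add hX0 (1 + t + _), Real.rpow_add hX0 (1 + t),
              Real.rpow_add hX0 1, Real.rpow_one]
        _ ≤ 1 := Real.rpow_le_one_of_one_le_of_nonpos hX1 (by linarith)
    linarith
  have e1 := key k le_rfl (by omega)
  have e2 := key (k + 1) (by omega) le_rfl
  obtain ⟨-, -, h⟩ := hm₀ m hmm k (Finset.mem_range.2 (by omega))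
  apply h
  have hden0 : (x.den : ℤ) ≠ 0 := by exact_mod_cast x.den_nz
  apply mul_right_cancel₀ hden0
  linear_combination Q (k + 1) m * e1 - Q k m * e2

theorem irrationalityExponent_eq_of_approximations {ξ c : ℝ} (hc : 2 ≤ c) {d : ℕ} (hd : 2 ≤ d)
    {δ : ℕ → ℕ} (hδ : StrictMono δ) {C : ℝ} (hC : 0 ≤ C) {P Q : ℕ → ℕ → ℤ}
    (hQ0 : ∀ k, ∀ᶠ m in atTop, Q k m ≠ 0)
    (hQ : ∀ k, ∀ᶠ m in atTop, |(Q k m : ℝ)| ≤ (c ^ d ^ m) ^ (δ k + C))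
    (hR0 : ∀ k, ∀ᶠ m in atTop, Q k m * ξ - P k m ≠ 0)
    (hR : ∀ k, ∀ᶠ m in atTop, |Q k m * ξ - P k m| ≤ (c ^ d ^ m) ^ (C - δ (k + 1)))
    (hdet : ∀ k, ∀ᶠ m in atTop, P k m * Q (k + 1) m ≠ P (k + 1) m * Q k m) :
    irrationalityExponent ξ =
      1 + limsup (fun k : ℕ => (((δ (k + 1) : ℝ) / (δ k : ℝ) : ℝ) : EReal)) atTop := by
  set L := limsup (fun k : ℕ => (((δ (k + 1) : ℝ) / (δ k : ℝ) : ℝ) : EReal)) atTop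
  -- `δ 0` may be 0, making the first ratio a default value; the limsup does not see it.
  have hδpos : ∀ᶠ k in atTop, (0 : ℝ) < δ k := by
    filter_upwards [eventually_ge_atTop 1] with k hk
    exact_mod_cast hk.trans hδ.le_apply
  have hsub : ∀ {μ : ℝ}, ((μ : ℝ) : EReal) < 1 + L → ((μ - 1 : ℝ) : EReal) < L := by
    intro μ h
    by_contra! h'
    have := h.trans_le (add_le_add_right h' 1)
    rw [← EReal.coe_one, ← EReal.coe_add] at this
    simp at this
  apply le_antisymm
  · apply sSup_le
    rintro _ ⟨μ, hμ, rfl⟩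
    by_contra! h
    have h1 : L < ((μ - 1 : ℝ) : EReal) := by
      by_contra! h'
      have := (add_le_add_right h' 1).trans_lt h
      rw [← EReal.coe_one, ← EReal.coe_add] at this
      simp at this
    obtain ⟨ℓ, hℓ1, hℓ2⟩ := EReal.lt_iff_exists_real_btwn.1 h1
    have hev := eventually_lt_of_limsup_lt hℓ1
    have hℓ0 : 0 ≤ ℓ := by
      obtain ⟨k, hk⟩ := hev.exists
      have h2 : (δ (k + 1) : ℝ) / (δ k : ℝ) < ℓ := by exact_mod_cast hk
      exact (by positivity : (0 : ℝ) ≤ (δ (k + 1) : ℝ) / (δ k : ℝ)).trans h2.le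
    refine hμ (finite_of_approximations hc hd hδ hC hQ hR hdet hℓ0 (by exact_mod_cast hℓ2) ?_)
    filter_upwards [hev, hδpos] with k hk hk0
    have h2 : (δ (k + 1) : ℝ) / (δ k : ℝ) < ℓ := by exact_mod_cast hk
    exact ((div_lt_iff₀ hk0).1 h2).le
  · by_contra! h
    -- Monotonicity makes the ratios at least 1, so 1 + L exceeds 1 and the test exponent μ can be
    -- taken above 1.
    have hL1 : (1 : EReal) ≤ L := by
      apply le_limsup_of_frequently_le
      · apply Eventually.frequently
        filter_upwards [hδpos] with k hk
        have h2 : (1 : ℝ) ≤ (δ (k + 1) : ℝ) / (δ k : ℝ) :=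
          (one_le_div hk).2 (by exact_mod_cast hδ.monotone (Nat.le_succ k))
        exact_mod_cast h2
      · isBoundedDefault
    have h1L : (1 : EReal) < 1 + L := by
      refine lt_of_lt_of_le ?_ (add_le_add_right hL1 1)
      rw [← EReal.coe_one, ← EReal.coe_add]
      exact_mod_cast (by norm_num : (1 : ℝ) < 1 + 1)
    obtain ⟨μ, hμ1, hμ2⟩ := EReal.lt_iff_exists_real_btwn.1 (max_lt h h1L)
    -- The gap ν - μ, multiplied by δ k, outgrows the error terms in C.
    obtain ⟨ν, hν1, hν2⟩ := EReal.lt_iff_exists_real_btwn.1 hμ2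
    have hμν : μ < ν := by exact_mod_cast hν1
    have hμ1' : 1 < μ := by exact_mod_cast (le_max_right _ _).trans_lt hμ1
    have hfr := frequently_lt_of_lt_limsup (by isBoundedDefault) (hsub hν2)
    have hbig : ∀ᶠ k in atTop, (μ - 1) * C + C < (ν - μ) * δ k :=
      ((tendsto_natCast_atTop_atTop.comp hδ.tendsto_atTop).const_mul_atTop
        (sub_pos.2 hμν)).eventually_gt_atTop _
    obtain ⟨k, hk1, hk2, hk3⟩ := (hfr.and_eventually (hbig.and hδpos)).exists
    have hk1' : ν - 1 < (δ (k + 1) : ℝ) / (δ k : ℝ) := by exact_mod_cast hk1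
    rw [lt_div_iff₀ hk3] at hk1'
    have hinf := infinite_of_approximations hc hd (hQ0 k) (hQ k) (hR0 k) (hR k) hC hk3.le hμ1'.le
      (by linarith)
    have h3 : ((μ : ℝ) : EReal) ≤ irrationalityExponent ξ := le_sSup ⟨μ, hinf, rfl⟩
    exact absurd ((le_max_left _ _).trans_lt hμ1) (not_lt.2 h3)

/-! ### Approximations to the values of a Mahler function -/

theorem exists_approximations {d : ℕ} (hd : 2 ≤ d) {A B : ℚ[X]} (hB : B ≠ 0)
    {f : LaurentSeries ℚ} (hf : f = ofPoly A / ofPoly B * substPow d (one_le_two.trans hd) f)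
    (hirr : ¬ IsRational f) {b : ℤ} (hb : 2 ≤ |b|) (hconv : (b : ℝ) ∈ discOfConvergence f)
    (hAB : ∀ m : ℕ, A.eval ((b : ℚ) ^ d ^ m) * B.eval ((b : ℚ) ^ d ^ m) ≠ 0) :
    ∃ (C : ℝ) (P Q : ℕ → ℕ → ℤ), 0 ≤ C ∧ (∀ k, ∀ᶠ m in atTop, Q k m ≠ 0) ∧
      (∀ k, ∀ᶠ m in atTop, |(Q k m : ℝ)| ≤ (|(b : ℝ)| ^ d ^ m) ^ (denDegree f k + C)) ∧
      (∀ k, ∀ᶠ m in atTop, Q k m * value f b - P k m ≠ 0) ∧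
      (∀ k, ∀ᶠ m in atTop,
        |Q k m * value f b - P k m| ≤ (|(b : ℝ)| ^ d ^ m) ^ (C - denDegree f (k + 1))) ∧
      (∀ k, ∀ᶠ m in atTop, P k m * Q (k + 1) m ≠ P (k + 1) m * Q k m) := by
  have hb' : 2 ≤ |(b : ℝ)| := by exact_mod_cast hb
  have hb1 : 1 ≤ |(b : ℝ)| := by linarith
  have hb0 : (b : ℝ) ≠ 0 := hconv.1
  have hpow0 : ∀ m, (b : ℝ) ^ d ^ m ≠ 0 := fun m => pow_ne_zero _ hb0
  have hle : ∀ m, |(b : ℝ)| ≤ |(b : ℝ) ^ d ^ m| := fun m => by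
    rw [abs_pow]; exact le_self_pow₀ hb1 (by positivity)
  have hdisc : ∀ m, (b : ℝ) ^ d ^ m ∈ discOfConvergence f :=
    fun m => discOfConvergence_mono hconv (hle m)
  have htend : Tendsto (fun m => |(b : ℝ) ^ d ^ m|) atTop atTop := by
    simpa only [abs_pow] using tendsto_pow_pow hb' hd
  have heval : ∀ (R : ℚ[X]) (m : ℕ),
      aeval ((b : ℝ) ^ d ^ m) R = ((R.eval ((b : ℚ) ^ d ^ m) : ℚ) : ℝ) := by
    intro R m
    have := aeval_algebraMap_apply ℝ ((b : ℚ) ^ d ^ m) R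
    simpa using this
  have hA0 : ∀ m, aeval ((b : ℝ) ^ d ^ m) A ≠ 0 := fun m => by
    rw [heval]; exact_mod_cast left_ne_zero_of_mul (hAB m)
  have hB0 : ∀ m, aeval ((b : ℝ) ^ d ^ m) B ≠ 0 := fun m => by
    rw [heval]; exact_mod_cast right_ne_zero_of_mul (hAB m)
  set p : ℕ → ℚ[X] := fun k => (continuants (partialQuotient f) k).1
  set q : ℕ → ℚ[X] := fun k => (continuants (partialQuotient f) k).2
  obtain ⟨N, hN0, hN⟩ := exists_int_mul_aeval_pair A B
  choose M hM0 hM using fun k => exists_int_mul_aeval_pair (p k) (q k)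
  choose uA huA using fun y => (hN y).1
  choose uB huB using fun y => (hN y).2
  choose uP huP using fun k y => (hM k y).1
  choose uQ huQ using fun k y => (hM k y).2
  have hNR : (N : ℝ) ≠ 0 := by exact_mod_cast hN0
  have hMR : ∀ k, (M k : ℝ) ≠ 0 := fun k => by exact_mod_cast hM0 k
  have hprod : ∀ {R : ℚ[X]} {u : ℤ → ℤ}, (∀ y, (u y : ℝ) = N * aeval (y : ℝ) R) → ∀ m : ℕ,
      ((∏ t ∈ Finset.range m, u (b ^ d ^ t) : ℤ) : ℝ) =
        (N : ℝ) ^ m * ∏ t ∈ Finset.range m, aeval ((b : ℝ) ^ d ^ t) R := by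
    intro R u hu m
    rw [Int.cast_prod]
    simp only [hu]
    rw [Finset.prod_mul_distrib, Finset.prod_const, Finset.card_range]
    push_cast
    rfl
  have hbound : ∀ {R : ℚ[X]} {u : ℤ → ℤ}, (∀ y, (u y : ℝ) = N * aeval (y : ℝ) R) →
      ∃ C : ℕ, ∀ m : ℕ, |((∏ t ∈ Finset.range m, u (b ^ d ^ t) : ℤ) : ℝ)| ≤
        (|(b : ℝ)| ^ d ^ m) ^ C := by
    intro R u hu
    -- Applying the bound to N·R instead of R absorbs the factor N^m from clearing denominators.
    obtain ⟨C, hC⟩ := exists_abs_prod_aeval_le (Polynomial.C (N : ℚ) * R) hd hb'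
    refine ⟨C, fun m => ?_⟩
    convert! hC m using 2
    rw [Int.cast_prod]
    refine Finset.prod_congr rfl fun t _ => ?_
    rw [hu, map_mul, aeval_C]
    simp
  obtain ⟨CA, hCA⟩ := hbound huA
  obtain ⟨CB, hCB⟩ := hbound huB
  have hUA0 : ∀ m, ((∏ t ∈ Finset.range m, uA (b ^ d ^ t) : ℤ) : ℝ) ≠ 0 := fun m => by
    rw [hprod huA]
    exact mul_ne_zero (pow_ne_zero _ hNR) (Finset.prod_ne_zero_iff.2 fun t _ => hA0 t)
  have hUB0 : ∀ m, ((∏ t ∈ Finset.range m, uB (b ^ d ^ t) : ℤ) : ℝ) ≠ 0 := fun m => by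
    rw [hprod huB]
    exact mul_ne_zero (pow_ne_zero _ hNR) (Finset.prod_ne_zero_iff.2 fun t _ => hB0 t)
  have hrem : ∀ k m, (((∏ t ∈ Finset.range m, uB (b ^ d ^ t)) * uQ k (b ^ d ^ m) : ℤ) : ℝ) *
      value f b - (((∏ t ∈ Finset.range m, uA (b ^ d ^ t)) * uP k (b ^ d ^ m) : ℤ) : ℝ) =
      ((∏ t ∈ Finset.range m, uA (b ^ d ^ t) : ℤ) : ℝ) * (M k * (aeval ((b : ℝ) ^ d ^ m) (q k) *
        value f ((b : ℝ) ^ d ^ m) - aeval ((b : ℝ) ^ d ^ m) (p k))) := by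
    intro k m
    rw [Int.cast_mul, Int.cast_mul, hprod huA, hprod huB, huP, huQ]
    have h := value_iterate hB hf hdisc m
    push_cast
    linear_combination (N : ℝ) ^ m * M k * aeval ((b : ℝ) ^ d ^ m) (q k) * h
  have hqv : ∀ k m, HasValue (ofPoly (q k)) ((b : ℝ) ^ d ^ m) (aeval ((b : ℝ) ^ d ^ m) (q k)) :=
    fun k m => hasValue_ofPoly (hpow0 m) _
  have hrv : ∀ k m, HasValue (remainder f k) ((b : ℝ) ^ d ^ m)
      (aeval ((b : ℝ) ^ d ^ m) (q k) * value f ((b : ℝ) ^ d ^ m) -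
        aeval ((b : ℝ) ^ d ^ m) (p k)) := fun k m =>
    ((hasValue_of_mem_disc (hdisc m)).ofPoly_mul (hpow0 m) _).sub (hasValue_ofPoly (hpow0 m) _)
  have hqe := fun k => eventually_ne_zero_and_le (ofPoly_ne_zero (continuants_snd_ne_zero hirr k))
    hb0 (hasValue_ofPoly hb0 _).summable hle htend (hqv k) |(M k : ℝ)|
  have hre := fun k => eventually_ne_zero_and_le (remainder_ne_zero_and_order hirr k).1
    hb0 (((hasValue_of_mem_disc hconv).ofPoly_mul hb0 _).sub (hasValue_ofPoly hb0 _)).summable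
    hle htend (hrv k) |(M k : ℝ)|
  have hX1 : ∀ m, 1 ≤ |(b : ℝ)| ^ d ^ m := fun m => one_le_pow₀ hb1
  have hcomb : ∀ (m c : ℕ) (e : ℤ) (r u v w : ℝ), |u| ≤ (|(b : ℝ)| ^ d ^ m) ^ c →
      |v| * |w| ≤ |(b : ℝ) ^ d ^ m| ^ e → (c : ℝ) + e ≤ r →
      |u * (v * w)| ≤ (|(b : ℝ)| ^ d ^ m) ^ r := by
    intro m c e r u v w hu hvw hr
    have hX0 : 0 < |(b : ℝ)| ^ d ^ m := zero_lt_one.trans_le (hX1 m)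
    rw [abs_pow] at hvw
    rw [abs_mul, abs_mul]
    refine (mul_le_mul hu hvw (by positivity) (by positivity)).trans ?_
    rw [← Real.rpow_natCast _ c, ← Real.rpow_intCast _ e, ← Real.rpow_add hX0]
    exact Real.rpow_le_rpow_of_exponent_le (hX1 m) hr
  -- `CA` and `CB` come from the two products, and 1 from the spare factor X in
  -- `eventually_ne_zero_and_le`, which hides all dependence on k.
  refine ⟨CA + CB + 1, fun k m => (∏ t ∈ Finset.range m, uA (b ^ d ^ t)) * uP k (b ^ d ^ m),
    fun k m => (∏ t ∈ Finset.range m, uB (b ^ d ^ t)) * uQ k (b ^ d ^ m), by positivity,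
    fun k => ?_, fun k => ?_, fun k => ?_, fun k => ?_, fun k => ?_⟩
  · filter_upwards [hqe k] with m hm
    have h : (((∏ t ∈ Finset.range m, uB (b ^ d ^ t)) * uQ k (b ^ d ^ m) : ℤ) : ℝ) ≠ 0 := by
      rw [Int.cast_mul, huQ]
      push_cast [← Int.cast_prod]
      exact mul_ne_zero (hUB0 m) (mul_ne_zero (hMR k) hm.1)
    exact_mod_cast h
  · filter_upwards [hqe k] with m hm
    rw [Int.cast_mul, huQ]
    have h2 := hm.2
    rw [order_ofPoly (continuants_snd_ne_zero hirr k), ← denDegree_eq hirr] at h2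
    rw [Int.cast_pow]
    refine hcomb m CB _ _ _ _ _ (hCB m) h2 ?_
    push_cast
    linarith [Nat.cast_nonneg (α := ℝ) CA]
  · filter_upwards [hre k] with m hm
    rw [hrem]
    exact mul_ne_zero (hUA0 m) (mul_ne_zero (hMR k) hm.1)
  · filter_upwards [hre k] with m hm
    rw [hrem]
    have h2 := hm.2
    rw [(remainder_ne_zero_and_order hirr k).2] at h2
    refine hcomb m CA _ _ _ _ _ (hCA m) h2 ?_
    push_cast
    linarith [Nat.cast_nonneg (α := ℝ) CB]
  · refine Eventually.of_forall fun m h => ?_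
    have h1 := congrArg (Int.cast : ℤ → ℝ) h
    simp only [Int.cast_mul, huP, huQ] at h1
    have h2 := congrArg (aeval ((b : ℝ) ^ d ^ m)) (continuants_det (partialQuotient f) k)
    simp only [map_sub, map_mul, map_pow, map_neg, map_one] at h2
    rw [Int.cast_pow] at h1
    have h3 : ((∏ t ∈ Finset.range m, uA (b ^ d ^ t) : ℤ) : ℝ) *
        ((∏ t ∈ Finset.range m, uB (b ^ d ^ t) : ℤ) : ℝ) * M k * M (k + 1) *
          (-1) ^ (k + 1) = 0 := by
      rw [← h2]
      linear_combination h1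
    have h4 : ((-1 : ℝ)) ^ (k + 1) ≠ 0 := pow_ne_zero _ (by norm_num)
    exact mul_ne_zero (mul_ne_zero (mul_ne_zero (mul_ne_zero (hUA0 m) (hUB0 m)) (hMR k))
      (hMR (k + 1))) h4 h3

end Mahler

theorem theorem2 (d : ℕ) (hd : 2 ≤ d) (A B : ℚ[X]) (hB : B ≠ 0) (f : LaurentSeries ℚ)
    (hf : f = Mahler.ofPoly A / Mahler.ofPoly B *
      Mahler.substPow d (one_le_two.trans hd) f)
    (hirr : ¬ Mahler.IsRational f)
    (b : ℤ) (hb : 2 ≤ |b|) (hconv : (b : ℝ) ∈ Mahler.discOfConvergence f)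
    (hAB : ∀ m : ℕ, A.eval ((b : ℚ) ^ d ^ m) * B.eval ((b : ℚ) ^ d ^ m) ≠ 0) :
    Mahler.irrationalityExponent (Mahler.value f (b : ℝ)) =
      1 + limsup (fun k : ℕ =>
        (((Mahler.denDegree f (k + 1) : ℝ) / (Mahler.denDegree f k : ℝ) : ℝ) : EReal)) atTop := by
  obtain ⟨C, P, Q, hC, hQ0, hQ, hR0, hR, hdet⟩ :=
    Mahler.exists_approximations hd hB hf hirr hb hconv hAB
  exact Mahler.irrationalityExponent_eq_of_approximations (by exact_mod_cast hb) hd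
    (Mahler.denDegree_strictMono hirr) hC hQ0 hQ hR0 hR hdet
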